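/- Let $d\in\{2,3\}$ and let $\Omega\subset\mathbb R^d$ be a nonempty polygonal/polyhedral open set. Write $(\cdot,\cdot)$, $\|\cdot\|$ for the scalar product and norm of $L^2(\Omega)$, and let $k\ge1$. Let $V,W\subset H^1(\Omega)$ be subspaces and $a:V\times W\to\mathbb R$ a bilinear form such that for all $f,g\in L^2(\Omega)$ the forward problem ($u\in V$, $a(u,w)=(f,w)$ for all $w\in W$) and the adjoint problem ($z\in W$, $a(v,z)=(g,v)$ for all $v\in V$) are uniquely solvable, with solutions in $H^2(\Omega)$ satisfying $|u|_{H^2(\Omega)}\le c_{a,\Omega}\|f\|$ and $|z|_{H^2(\Omega)}\le c_{a,\Omega}\|g\|$. Let $\mathcal T_h$ be a conforming triangulation of $\Omega$ with mesh size $h=\max_{K\in\mathcal T_h}\operatorname{diam}K$, and let $V_h=W_h$ be a subspace of $X_h^k=\{v\in H^1(\Omega): v|_K\in\mathbb P_k(K)\ \forall K\in\mathcal T_h\}$. Put $V^m=V\cap H^m(\Omega)$ and $W^m=W\cap H^m(\Omega)$. Let $a_h$ be a bilinear form on $(V^2+V_h)\times(W^2+V_h)$, let $s_p$ and $s_a$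 be symmetric positive semi-definite bilinear forms on $V^{k+1}+V_h$ and $W^{k+1}+V_h$, respectively, and set $|x|_{S_y}=s_y(x,x)^{1/2}$ for $y=p,a$. Let $\pi_V:V^2\to V_h$ and $\pi_W:W^2\to V_h$ be maps, $\|\cdot\|_+$ and $\|\cdot\|_{\mathcal L}$ seminorms on $V^2+V_h$, $\|\cdot\|_*$ a seminorm on $W^2+V_h$, and $\epsilon=\epsilon(h)\ge0$. Assume: 1. (Strong consistency) If $u$ solves the forward problem with data $f$, then $a_h(u,\varphi)=(f,\varphi)$ for all $\varphi\in W^2+V_h$; if $z$ solves the adjoint problem with data $g$, then $a_h(\phi,z)=(\phi,g)$ for all $\phi\in V^2+V_h$. 2. (Interpolation) $\|v-\pi_Vv\|+h\|\nabla(v-\pi_Vv)\|\le c_ih^{k+1}|v|_{H^{k+1}(\Omega)}$ for all $v\in V^{k+1}$, and the same for $\pi_W$ on $W^{k+1}$. 3. (Continuity) For all $v\in V^2$, $y\in W^2$ and $v_h,x_h\in V_h$, $$a_h(v-\pi_Vv,x_h)\le\|v-\pi_Vv\|_+\,(c_a|x_h|_{S_a}+\epsilon\|x_h\|),$$ $$a_h(v-v_h,y-\pi_Wy)\le\|y-\pi_Wy\|_*\,(c_a\|v-\pi_Vv\|_{\mathcal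 L}+c_a|v_h-\pi_Vv|_{S_p}+\epsilon\|v-v_h\|).$$ 4. (Approximation) For all $v\in V^{k+1}$, $w\in W^{k+1}$, $$\|v-\pi_Vv\|_{\mathcal L}+\|v-\pi_Vv\|_++|v-\pi_Vv|_{S_p}\le c_{a,\gamma}h^k|v|_{H^{k+1}(\Omega)},\qquad \|w-\pi_Ww\|_*+|w-\pi_Ww|_{S_a}\le c_{a,\gamma}h^k|w|_{H^{k+1}(\Omega)},$$ and for all $v\in V^2$, $w\in W^2$: $\|v-\pi_Vv\|_+\le c_{a,\gamma}h|v|_{H^2(\Omega)}$ and $\|w-\pi_Ww\|_*\le c_{a,\gamma}h|w|_{H^2(\Omega)}$. 5. (Upper bounds) $|\pi_Vv|_{S_p}\le c_{a,\gamma}h|v|_{H^2(\Omega)}$ for all $v\in V^2$ and $|\pi_Ww|_{S_a}\le c_{a,\gamma}h|w|_{H^2(\Omega)}$ for all $w\in W^2$. 6. (Smallness) $c_{a,\gamma}\,c_{a,\Omega}\,h\,\epsilon\le\frac16$. 7. (Discrete Gårding inequality) For some $\lambda\in\mathbb R$, $\|\nabla v_h\|^2-\lambda\|v_h\|^2\le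 c_G\,(a_h(v_h,v_h)+s_p(v_h,v_h))$ for all $v_h\in V_h$. 8. $s_a=s_p$ on $V_h\times V_h$. Let $f\in L^2(\Omega)$ be such that the forward solution $u$ belongs to $H^{k+1}(\Omega)$. Then there is exactly one pair $(u_h,z_h)\in V_h\times V_h$ with $$a_h(u_h,w_h)+s_a(z_h,w_h)=(f,w_h),\qquad a_h(v_h,z_h)-s_p(u_h,v_h)=-s_p(u,v_h)\qquad\forall v_h,w_h\in V_h,$$ and $$\|\nabla(u-u_h)\|\le C\,h^k\,|u|_{H^{k+1}(\Omega)},$$ where $C$ depends only on $d$, $\Omega$, $k$, $\lambda$ and the positive constants $c_{a,\Omega},c_i,c_a,c_{a,\gamma},c_G$. In particular no inverse inequality is needed: the triangulation need not be shape regular or quasi-uniform, and $C$ does not depend on it. -/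

import Mathlib

open MeasureTheory
open scoped ContDiff

noncomputable section

namespace StabFEM

/-- Euclidean space `ℝᵈ`. -/
abbrev E (d : ℕ) := EuclideanSpace ℝ (Fin d)

/-- The real Hilbert space `L²(Ω)`. -/
abbrev L2 {d : ℕ} (Ω : Set (E d)) := Lp ℝ 2 (volume.restrict Ω)

/-- Test functions: smooth functions whose support is a compact subset of `Ω`. -/
structure IsTestFunction {d : ℕ} (Ω : Set (E d)) (φ : E d → ℝ) : Prop where
  smooth : ContDiff ℝ ∞ φ
  compact : HasCompactSupport φ
  support : tsupport φ ⊆ Ω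

/-- The classical partial derivative `∂_{β 0} ⋯ ∂_{β (m-1)} φ` of order `m`. -/
def partialDeriv {d m : ℕ} (β : Fin m → Fin d) (φ : E d → ℝ) (x : E d) : ℝ :=
  iteratedFDeriv ℝ m φ x (fun i => EuclideanSpace.single (β i) 1)

/-- `g ∈ L²(Ω)` is the weak derivative `∂_{β 0} ⋯ ∂_{β (m-1)} v` on `Ω`. -/
def HasWeakDeriv {d m : ℕ} (Ω : Set (E d)) (β : Fin m → Fin d) (v g : L2 Ω) : Prop :=
  ∀ φ : E d → ℝ, IsTestFunction Ω φ →
    ∫ x in Ω, v x * partialDeriv β φ x = (-1) ^ m * ∫ x in Ω, g x * φ x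

lemma IsTestFunction.memLp_partialDeriv {d m : ℕ} {Ω : Set (E d)} {φ : E d → ℝ}
    (h : IsTestFunction Ω φ) (β : Fin m → Fin d) :
    MemLp (partialDeriv β φ) 2 (volume.restrict Ω) := by
  have hc : Continuous (iteratedFDeriv ℝ m φ) :=
    h.smooth.continuous_iteratedFDeriv (by exact_mod_cast le_top)
  have hc' : Continuous (partialDeriv β φ) := by
    exact (ContinuousMultilinearMap.apply ℝ (fun _ : Fin m => E d) ℝ
      (fun i => EuclideanSpace.single (β i) 1)).continuous.comp hc
  have hs : HasCompactSupport (partialDeriv β φ) := by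
    refine (h.compact.iteratedFDeriv (𝕜 := ℝ) m).mono' ?_
    refine subset_trans ?_ subset_closure
    intro x hx h0
    apply hx
    simp only [partialDeriv, h0]
    rfl
  exact hc'.memLp_of_hasCompactSupport hs

lemma IsTestFunction.memLp {d : ℕ} {Ω : Set (E d)} {φ : E d → ℝ}
    (h : IsTestFunction Ω φ) : MemLp φ 2 (volume.restrict Ω) :=
  h.smooth.continuous.memLp_of_hasCompactSupport h.compact

lemma integral_add_mul {d : ℕ} {Ω : Set (E d)} (v w : L2 Ω) {ψ : E d → ℝ}
    (h : MemLp ψ 2 (volume.restrict Ω)) :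
    ∫ x in Ω, (v + w : L2 Ω) x * ψ x = (∫ x in Ω, v x * ψ x) + ∫ x in Ω, w x * ψ x := by
  have hv : Integrable (fun x => v x * ψ x) (volume.restrict Ω) := (Lp.memLp v).integrable_mul h
  have hw : Integrable (fun x => w x * ψ x) (volume.restrict Ω) := (Lp.memLp w).integrable_mul h
  rw [← integral_add hv hw]
  refine integral_congr_ae ?_
  filter_upwards [Lp.coeFn_add v w] with x hx
  simp only [hx, Pi.add_apply]
  ring

lemma integral_smul_mul {d : ℕ} {Ω : Set (E d)} (c : ℝ) (v : L2 Ω) (ψ : E d → ℝ) :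
    ∫ x in Ω, (c • v : L2 Ω) x * ψ x = c * ∫ x in Ω, v x * ψ x := by
  rw [← integral_const_mul]
  refine integral_congr_ae ?_
  filter_upwards [Lp.coeFn_smul c v] with x hx
  simp only [hx, Pi.smul_apply, smul_eq_mul]
  ring

lemma HasWeakDeriv.add {d m : ℕ} {Ω : Set (E d)} {β : Fin m → Fin d} {v w g k : L2 Ω}
    (hv : HasWeakDeriv Ω β v g) (hw : HasWeakDeriv Ω β w k) :
    HasWeakDeriv Ω β (v + w) (g + k) := by
  intro φ hφ
  rw [integral_add_mul _ _ (hφ.memLp_partialDeriv β), integral_add_mul _ _ hφ.memLp,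
    hv φ hφ, hw φ hφ]
  ring

lemma HasWeakDeriv.smul {d m : ℕ} {Ω : Set (E d)} {β : Fin m → Fin d} {v g : L2 Ω} (c : ℝ)
    (hv : HasWeakDeriv Ω β v g) : HasWeakDeriv Ω β (c • v) (c • g) := by
  intro φ hφ
  rw [integral_smul_mul, integral_smul_mul, hv φ hφ]
  ring

/-- The Sobolev space `H^m(Ω)`: all weak derivatives of order at most `m` are in `L²(Ω)`. -/
def sobolev {d : ℕ} (Ω : Set (E d)) (m : ℕ) : Submodule ℝ (L2 Ω) where
  carrier := {v | ∀ j ≤ m, ∀ β : Fin j → Fin d, ∃ g : L2 Ω, HasWeakDeriv Ω β v g}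
  zero_mem' := fun j _ β => ⟨0, by
    intro φ _
    have h0 : ∀ ψ : E d → ℝ, ∫ x in Ω, (0 : L2 Ω) x * ψ x = 0 := by
      intro ψ
      simpa using integral_smul_mul (0 : ℝ) (0 : L2 Ω) ψ
    rw [h0, h0, mul_zero]⟩
  add_mem' := fun {v w} hv hw j hj β => by
    obtain ⟨g, hg⟩ := hv j hj β
    obtain ⟨k, hk⟩ := hw j hj β
    exact ⟨g + k, hg.add hk⟩
  smul_mem' := fun c v hv j hj β => by
    obtain ⟨g, hg⟩ := hv j hj β
    exact ⟨c • g, hg.smul c⟩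

open Classical in
/-- The weak derivative of `v` in the directions `β` (unique when `Ω` is open);
`0` if there is none in `L²(Ω)`. -/
def weakDeriv {d m : ℕ} (Ω : Set (E d)) (β : Fin m → Fin d) (v : L2 Ω) : L2 Ω :=
  if h : ∃ g : L2 Ω, HasWeakDeriv Ω β v g then h.choose else 0

/-- The seminorm `|v|_{H^m(Ω)} = ‖D^m v‖` for `v ∈ H^m(Ω)`, with the Euclidean norm of the tensor
of all derivatives of order `m`. -/
def seminormH {d : ℕ} (Ω : Set (E d)) (m : ℕ) (v : L2 Ω) : ℝ :=
  Real.sqrt (∑ β : Fin m → Fin d, ‖weakDeriv Ω β v‖ ^ 2)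

/-- The gradient norm `‖∇ v‖` in `L²(Ω)`. -/
def gradNorm {d : ℕ} (Ω : Set (E d)) (v : L2 Ω) : ℝ := seminormH Ω 1 v

/-- A conforming triangulation of `Ω ⊆ ℝᵈ`: a finite, purely `d`-dimensional simplicial complex
with union `closure Ω`, the open cells of which lie in `Ω`. An open set that has one is polygonal
(`d = 2`) or polyhedral (`d = 3`). -/
structure Triangulation {d : ℕ} (Ω : Set (E d)) where
  complex : Geometry.SimplicialComplex ℝ (E d)
  finite : complex.faces.Finite
  pure : ∀ s ∈ complex.faces, ∃ t ∈ complex.faces, s ⊆ t ∧ t.card = d + 1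
  space_eq : complex.space = closure Ω
  interior_subset : ∀ s ∈ complex.faces, interior (convexHull ℝ (s : Set (E d))) ⊆ Ω

/-- The (closed) cells `K` of a triangulation. -/
def Triangulation.cells {d : ℕ} {Ω : Set (E d)} (T : Triangulation Ω) : Set (Set (E d)) :=
  {K | ∃ s ∈ T.complex.faces, s.card = d + 1 ∧ K = convexHull ℝ (s : Set (E d))}

/-- The mesh size `h = max_K diam K`. -/
def Triangulation.meshSize {d : ℕ} {Ω : Set (E d)} (T : Triangulation Ω) : ℝ :=
  sSup (Metric.diam '' T.cells)

/-- The finite element space `X_h^k = {v ∈ H¹(Ω) : v|_K ∈ P_k(K) for all cells K}`. -/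
def Triangulation.feSpace {d : ℕ} {Ω : Set (E d)} (T : Triangulation Ω) (k : ℕ) :
    Submodule ℝ (L2 Ω) where
  carrier := {v | v ∈ sobolev Ω 1 ∧ ∀ K ∈ T.cells, ∃ p : MvPolynomial (Fin d) ℝ,
    p.totalDegree ≤ k ∧ ∀ᵐ x ∂volume.restrict Ω, x ∈ K → v x = MvPolynomial.eval (fun i => x i) p}
  zero_mem' := by
    refine ⟨Submodule.zero_mem _, fun K _ => ⟨0, by simp, ?_⟩⟩
    filter_upwards [Lp.coeFn_zero ℝ 2 (volume.restrict Ω)] with x hx _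
    simpa using hx
  add_mem' := by
    rintro v w ⟨hv, hv'⟩ ⟨hw, hw'⟩
    refine ⟨Submodule.add_mem _ hv hw, fun K hK => ?_⟩
    obtain ⟨p, hp, hpv⟩ := hv' K hK
    obtain ⟨q, hq, hqw⟩ := hw' K hK
    refine ⟨p + q, (MvPolynomial.totalDegree_add p q).trans (max_le hp hq), ?_⟩
    filter_upwards [hpv, hqw, Lp.coeFn_add v w] with x h1 h2 h3 hxK
    rw [h3, Pi.add_apply, h1 hxK, h2 hxK, map_add]
  smul_mem' := by
    rintro c v ⟨hv, hv'⟩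
    refine ⟨Submodule.smul_mem _ c hv, fun K hK => ?_⟩
    obtain ⟨p, hp, hpv⟩ := hv' K hK
    refine ⟨c • p, (MvPolynomial.totalDegree_smul_le c p).trans hp, ?_⟩
    filter_upwards [hpv, Lp.coeFn_smul c v] with x h1 h3 hxK
    rw [h3, Pi.smul_apply, h1 hxK, MvPolynomial.smul_eval, smul_eq_mul]

/-- `b` restricts to a bilinear form on `A × B`; its values elsewhere are irrelevant. -/
structure IsBilinOn {H : Type*} [AddCommGroup H] [Module ℝ H] (A B : Submodule ℝ H)
    (b : H → H → ℝ) : Prop where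
  add_left : ∀ x ∈ A, ∀ x' ∈ A, ∀ y ∈ B, b (x + x') y = b x y + b x' y
  smul_left : ∀ (c : ℝ), ∀ x ∈ A, ∀ y ∈ B, b (c • x) y = c * b x y
  add_right : ∀ x ∈ A, ∀ y ∈ B, ∀ y' ∈ B, b x (y + y') = b x y + b x y'
  smul_right : ∀ (c : ℝ), ∀ x ∈ A, ∀ y ∈ B, b x (c • y) = c * b x y

/-- `s` restricts to a symmetric positive semi-definite bilinear form on `A`. -/
structure IsStabilisationOn {H : Type*} [AddCommGroup H] [Module ℝ H] (A : Submodule ℝ H)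
    (s : H → H → ℝ) : Prop where
  bilin : IsBilinOn A A s
  symm : ∀ x ∈ A, ∀ y ∈ A, s x y = s y x
  nonneg : ∀ x ∈ A, 0 ≤ s x x

/-- The seminorm `|x|_S = s(x,x)^{1/2}` induced by a stabilisation form. -/
def stabNorm {H : Type*} (s : H → H → ℝ) (x : H) : ℝ := Real.sqrt (s x x)

/-- `N` restricts to a seminorm on `A`. -/
structure IsSeminormOn {H : Type*} [AddCommGroup H] [Module ℝ H] (A : Submodule ℝ H)
    (N : H → ℝ) : Prop where
  nonneg : ∀ x ∈ A, 0 ≤ N x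
  add_le : ∀ x ∈ A, ∀ y ∈ A, N (x + y) ≤ N x + N y
  smul : ∀ (c : ℝ), ∀ x ∈ A, N (c • x) = |c| * N x

/-- `u ∈ V` is a weak solution of the forward problem `a(u,w) = (f,w)` for all `w ∈ W`. -/
def SolvesForward {d : ℕ} {Ω : Set (E d)} (V W : Submodule ℝ (L2 Ω)) (a : L2 Ω → L2 Ω → ℝ)
    (f u : L2 Ω) : Prop :=
  u ∈ V ∧ ∀ w ∈ W, a u w = inner ℝ f w

/-- `z ∈ W` is a weak solution of the adjoint problem `a(v,z) = (g,v)` for all `v ∈ V`. -/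
def SolvesAdjoint {d : ℕ} {Ω : Set (E d)} (V W : Submodule ℝ (L2 Ω)) (a : L2 Ω → L2 Ω → ℝ)
    (g z : L2 Ω) : Prop :=
  z ∈ W ∧ ∀ v ∈ V, a v z = inner ℝ g v

/-- `(u_h, z_h) ∈ V_h × V_h` solves the stabilised finite element method
`a_h(u_h,w_h) + s_a(z_h,w_h) = (f,w_h)`, `a_h(v_h,z_h) - s_p(u_h,v_h) = -s_p(u,v_h)`. -/
structure SolvesFEM {d : ℕ} {Ω : Set (E d)} (Vh : Submodule ℝ (L2 Ω))
    (ah sa sp : L2 Ω → L2 Ω → ℝ) (f u uh zh : L2 Ω) : Prop where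
  primal_mem : uh ∈ Vh
  dual_mem : zh ∈ Vh
  primal : ∀ wh ∈ Vh, ah uh wh + sa zh wh = inner ℝ f wh
  dual : ∀ vh ∈ Vh, ah vh zh - sp uh vh = -sp u vh

end StabFEM

end

/-! Coercivity of the form is replaced by stability of the continuous problems. Let `ξ = uh - πV u`,
`δ = cγ * cΩ * h`, and let `M`, of order `h ^ k * |u|`, bound the approximation errors of `u`.
Testing the discrete equations with `zh` and `ξ` gives `|ξ|_Sp ^ 2 + |zh|_Sa ^ 2 = ah (u - πV u) zh
+ sp (u - πV u) ξ`. The right side contains `ε * ‖zh‖`, which the forward problem with data `zh`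
controls (`norm_dual_le`); since `δ * ε ≤ 1 / 6` it is absorbed, and both stabilisation seminorms
are `O(M)` (`stabNorm_add_le`). The adjoint problem with data `u - uh` then yields `‖u - uh‖ = O(δ *
M)`, one power of `h` better (`norm_error_le`). The primal equation tested with `ξ` bounds `ah ξ ξ +
sp ξ ξ` by `O(M ^ 2) + M * ε * ‖ξ‖`, and Gårding turns this into a gradient bound. The extra factor
`h` in `‖ξ‖` compensates `ε`, so no inverse inequality is needed. With zero data the same estimates
give `uh = zh = 0`; the linear system is square, so it is uniquely solvable. -/

noncomputable section

namespace StabFEM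

/-! ### Forms that are bilinear on subspaces, and Cauchy–Schwarz for semi-definite ones. -/

section Stabilisation

variable {H : Type*} [AddCommGroup H] [Module ℝ H] {A B : Submodule ℝ H} {s b : H → H → ℝ}

lemma IsBilinOn.mono {A' B' : Submodule ℝ H} (hb : IsBilinOn A B b) (hA : A' ≤ A) (hB : B' ≤ B) :
    IsBilinOn A' B' b where
  add_left x hx x' hx' y hy := hb.add_left x (hA hx) x' (hA hx') y (hB hy)
  smul_left c x hx y hy := hb.smul_left c x (hA hx) y (hB hy)
  add_right x hx y hy y' hy' := hb.add_right x (hA hx) y (hB hy) y' (hB hy')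
  smul_right c x hx y hy := hb.smul_right c x (hA hx) y (hB hy)

lemma IsBilinOn.sub_left (hb : IsBilinOn A B b) {x x' y : H} (hx : x ∈ A) (hx' : x' ∈ A)
    (hy : y ∈ B) : b (x - x') y = b x y - b x' y := by
  rw [sub_eq_add_neg, ← neg_one_smul ℝ x', hb.add_left x hx _ (A.smul_mem _ hx') y hy,
    hb.smul_left _ x' hx' y hy]
  ring

lemma IsBilinOn.sub_right (hb : IsBilinOn A B b) {x y y' : H} (hx : x ∈ A) (hy : y ∈ B)
    (hy' : y' ∈ B) : b x (y - y') = b x y - b x y' := by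
  rw [sub_eq_add_neg, ← neg_one_smul ℝ y', hb.add_right x hx y hy _ (B.smul_mem _ hy'),
    hb.smul_right _ x hx y' hy']
  ring

lemma IsBilinOn.zero_left (hb : IsBilinOn A B b) {y : H} (hy : y ∈ B) : b 0 y = 0 := by
  simpa using hb.smul_left 0 0 A.zero_mem y hy

/-- The bilinear map on `A × B` given by a form that is bilinear there. -/
def IsBilinOn.toBilin (hb : IsBilinOn A B b) : A →ₗ[ℝ] B →ₗ[ℝ] ℝ :=
  LinearMap.mk₂ ℝ (fun x y => b x y)
    (fun x x' y => hb.add_left x x.2 x' x'.2 y y.2)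
    (fun c x y => hb.smul_left c x x.2 y y.2)
    (fun x y y' => hb.add_right x x.2 y y.2 y' y'.2)
    (fun c x y => hb.smul_right c x x.2 y y.2)

lemma IsStabilisationOn.mono {A' : Submodule ℝ H} (hs : IsStabilisationOn A s) (hA : A' ≤ A) :
    IsStabilisationOn A' s where
  bilin := hs.bilin.mono hA hA
  symm x hx y hy := hs.symm x (hA hx) y (hA hy)
  nonneg x hx := hs.nonneg x (hA hx)

lemma stabNorm_nonneg {H : Type*} (s : H → H → ℝ) (x : H) : 0 ≤ stabNorm s x := Real.sqrt_nonneg _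

lemma IsStabilisationOn.sq_stabNorm (hs : IsStabilisationOn A s) {x : H} (hx : x ∈ A) :
    stabNorm s x ^ 2 = s x x := Real.sq_sqrt (hs.nonneg x hx)

/-- The Cauchy–Schwarz inequality for stabilisation forms. -/
lemma IsStabilisationOn.abs_le (hs : IsStabilisationOn A s) {x y : H} (hx : x ∈ A) (hy : y ∈ A) :
    |s x y| ≤ stabNorm s x * stabNorm s y := by
  -- Expansion of `s (x + t y) (x + t y) ≥ 0`; the discriminant argument also covers the degenerate
  -- case `s y y = 0`.
  have key : ∀ t : ℝ, 0 ≤ s y y * (t * t) + 2 * s x y * t + s x x := by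
    intro t
    have hty := A.smul_mem t hy
    have h := hs.nonneg (x + t • y) (A.add_mem hx hty)
    rw [hs.bilin.add_left x hx _ hty _ (A.add_mem hx hty), hs.bilin.add_right x hx x hx _ hty,
      hs.bilin.add_right _ hty x hx _ hty, hs.bilin.smul_left t y hy x hx,
      hs.bilin.smul_left t y hy _ hty, hs.bilin.smul_right t x hx y hy,
      hs.bilin.smul_right t y hy y hy, hs.symm y hy x hx] at h
    linarith
  have hd := discrim_le_zero key
  rw [discrim] at hd
  rw [stabNorm, stabNorm, ← Real.sqrt_mul (hs.nonneg x hx)]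
  exact Real.abs_le_sqrt (by linarith)

lemma IsStabilisationOn.le (hs : IsStabilisationOn A s) {x y : H} (hx : x ∈ A) (hy : y ∈ A) :
    s x y ≤ stabNorm s x * stabNorm s y := (le_abs_self _).trans (hs.abs_le hx hy)

lemma IsStabilisationOn.neg_le (hs : IsStabilisationOn A s) {x y : H} (hx : x ∈ A) (hy : y ∈ A) :
    -s x y ≤ stabNorm s x * stabNorm s y := (neg_le_abs _).trans (hs.abs_le hx hy)

end Stabilisation

/-! ### Weak derivatives and Sobolev seminorms. -/

section Sobolev

variable {d m : ℕ} {Ω : Set (E d)}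

/-- The fundamental lemma of the calculus of variations. It makes the choice in `weakDeriv` linear
on `sobolev Ω m`, whence the triangle inequality for `seminormH`. -/
lemma HasWeakDeriv.unique (hΩ : IsOpen Ω) {β : Fin m → Fin d} {v g k : L2 Ω}
    (hg : HasWeakDeriv Ω β v g) (hk : HasWeakDeriv Ω β v k) : g = k := by
  have hloc : ∀ w : L2 Ω, LocallyIntegrableOn w Ω volume := fun w =>
    locallyIntegrableOn_of_locallyIntegrable_restrict
      ((Lp.memLp w).locallyIntegrable (by norm_num))
  have h := hΩ.ae_eq_zero_of_integral_contDiff_smul_eq_zero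
    (f := fun x => g x - k x) ((hloc g).sub (hloc k)) (fun φ hφ hc hs => by
      have ht : IsTestFunction Ω φ := ⟨hφ, hc, hs⟩
      have h1 : ∫ x in Ω, g x * φ x = ∫ x in Ω, k x * φ x := by
        have := (hg φ ht).symm.trans (hk φ ht)
        exact mul_left_cancel₀ (pow_ne_zero m (by norm_num)) this
      have hi : ∀ w : L2 Ω, Integrable (fun x => w x * φ x) (volume.restrict Ω) :=
        fun w => (Lp.memLp w).integrable_mul ht.memLp
      have h2 : ∫ x in Ω, φ x • (g x - k x) = 0 := by
        rw [← sub_eq_zero.2 h1, ← integral_sub (hi g) (hi k)]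
        exact integral_congr_ae (.of_forall fun x => by simp only [smul_eq_mul]; ring)
      rw [← h2, setIntegral_eq_integral_of_forall_compl_eq_zero]
      intro x hx
      rw [image_eq_zero_of_notMem_tsupport fun h => hx (hs h), zero_smul])
  refine Lp.ext ?_
  rw [Filter.EventuallyEq, ae_restrict_iff' hΩ.measurableSet]
  filter_upwards [h] with x hx hxΩ
  exact sub_eq_zero.1 (hx hxΩ)

lemma HasWeakDeriv.weakDeriv_eq (hΩ : IsOpen Ω) {β : Fin m → Fin d} {v g : L2 Ω}
    (h : HasWeakDeriv Ω β v g) : weakDeriv Ω β v = g := by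
  have he : ∃ g, HasWeakDeriv Ω β v g := ⟨g, h⟩
  rw [weakDeriv, dif_pos he]
  exact he.choose_spec.unique hΩ h

lemma hasWeakDeriv_weakDeriv {β : Fin m → Fin d} {v : L2 Ω} (hv : v ∈ sobolev Ω m) :
    HasWeakDeriv Ω β v (weakDeriv Ω β v) := by
  have he : ∃ g, HasWeakDeriv Ω β v g := hv m le_rfl β
  rw [weakDeriv, dif_pos he]
  exact he.choose_spec

lemma sobolev_anti {j : ℕ} (h : j ≤ m) : sobolev Ω m ≤ sobolev Ω j :=
  fun _ hv i hi β => hv i (hi.trans h) β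

lemma seminormH_eq_norm (m : ℕ) (v : L2 Ω) :
    seminormH Ω m v = ‖WithLp.toLp 2 fun β : Fin m → Fin d => weakDeriv Ω β v‖ := by
  rw [PiLp.norm_eq_of_L2]
  rfl

lemma seminormH_nonneg (m : ℕ) (v : L2 Ω) : 0 ≤ seminormH Ω m v := Real.sqrt_nonneg _

lemma seminormH_zero (hΩ : IsOpen Ω) (m : ℕ) : seminormH Ω m (0 : L2 Ω) = 0 := by
  have h : ∀ β : Fin m → Fin d, weakDeriv Ω β (0 : L2 Ω) = 0 := fun β => by
    have := (hasWeakDeriv_weakDeriv (β := β) (zero_mem (sobolev Ω m))).smul 0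
    simpa using HasWeakDeriv.weakDeriv_eq hΩ this
  simp [seminormH, h]

lemma seminormH_sub_le (hΩ : IsOpen Ω) {v w : L2 Ω} (hv : v ∈ sobolev Ω m)
    (hw : w ∈ sobolev Ω m) : seminormH Ω m (v - w) ≤ seminormH Ω m v + seminormH Ω m w := by
  have h : ∀ β : Fin m → Fin d,
      weakDeriv Ω β (v - w) = weakDeriv Ω β v - weakDeriv Ω β w := fun β => by
    refine HasWeakDeriv.weakDeriv_eq hΩ ?_
    simpa [sub_eq_add_neg] using
      (hasWeakDeriv_weakDeriv (β := β) hv).add ((hasWeakDeriv_weakDeriv hw).smul (-1))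
  simp only [seminormH_eq_norm, h]
  exact norm_sub_le (WithLp.toLp 2 fun β : Fin m → Fin d => weakDeriv Ω β v)
    (WithLp.toLp 2 fun β : Fin m → Fin d => weakDeriv Ω β w)

end Sobolev

/-! ### Mesh size bounds and finite dimension of the finite element space. -/

namespace Triangulation

variable {d : ℕ} {Ω : Set (E d)} (T : Triangulation Ω)

lemma finite_cells : T.cells.Finite := by
  refine (T.finite.image fun s : Finset (E d) => convexHull ℝ (s : Set (E d))).subset ?_
  rintro K ⟨s, hs, -, rfl⟩
  exact ⟨s, hs, rfl⟩

lemma closure_subset_sUnion_cells : closure Ω ⊆ ⋃₀ T.cells := by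
  rw [← T.space_eq]
  intro x hx
  obtain ⟨s, hs, hxs⟩ := Geometry.SimplicialComplex.mem_space_iff.1 hx
  obtain ⟨t, ht, hst, hc⟩ := T.pure s hs
  exact ⟨_, ⟨t, ht, hc, rfl⟩, convexHull_mono (Finset.coe_subset.2 hst) hxs⟩

lemma subset_closure_of_mem_cells {K : Set (E d)} (hK : K ∈ T.cells) : K ⊆ closure Ω := by
  obtain ⟨s, hs, -, rfl⟩ := hK
  rw [← T.space_eq]
  exact T.complex.convexHull_subset_space hs

lemma isBounded_of_mem_cells {K : Set (E d)} (hK : K ∈ T.cells) : Bornology.IsBounded K := by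
  obtain ⟨s, -, -, rfl⟩ := hK
  exact isBounded_convexHull.2 s.finite_toSet.isBounded

lemma isBounded_closure {Ω : Set (E d)} (T : Triangulation Ω) : Bornology.IsBounded (closure Ω) :=
  ((Bornology.isBounded_sUnion T.finite_cells).2 fun _ => T.isBounded_of_mem_cells).subset
    T.closure_subset_sUnion_cells

/-- The `L²` term of the Gårding inequality carries a surplus factor `h ^ 2`; this bounds it
independently of the mesh. -/
lemma meshSize_le_diam : T.meshSize ≤ Metric.diam (closure Ω) := by
  refine Real.sSup_le ?_ Metric.diam_nonneg
  rintro _ ⟨K, hK, rfl⟩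
  exact Metric.diam_mono (T.subset_closure_of_mem_cells hK) T.isBounded_closure

lemma meshSize_pos (hd : 0 < d) (hΩ : Ω.Nonempty) : 0 < T.meshSize := by
  obtain ⟨x, hx⟩ := hΩ
  obtain ⟨K, hK, -⟩ := T.closure_subset_sUnion_cells (subset_closure hx)
  refine lt_of_lt_of_le ?_
    (le_csSup (T.finite_cells.image Metric.diam).bddAbove (Set.mem_image_of_mem _ hK))
  have hb := T.isBounded_of_mem_cells hK
  obtain ⟨s, -, hc, rfl⟩ := hK
  -- A cell has `d + 1 ≥ 2` vertices.
  obtain ⟨p, hp, q, hq, hpq⟩ := Finset.one_lt_card.1 (show 1 < s.card by omega)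
  exact (dist_pos.2 hpq).trans_le (Metric.dist_le_diam_of_mem hb
    (subset_convexHull ℝ _ hp) (subset_convexHull ℝ _ hq))

lemma finiteDimensional_feSpace (hΩ : IsOpen Ω) (k : ℕ) : FiniteDimensional ℝ (T.feSpace k) := by
  have := T.finite_cells.to_subtype
  -- Pairs of a function and polynomials representing it on the cells. As a relation, `G` needs no
  -- uniqueness of these polynomials: it embeds into the polynomial tuples because the cells cover
  -- `Ω`, and it projects onto `feSpace`.
  let G : Submodule ℝ (L2 Ω × (T.cells → MvPolynomial.restrictTotalDegree (Fin d) ℝ k)) :=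
    { carrier := {x | x.1 ∈ T.feSpace k ∧ ∀ K : T.cells, ∀ᵐ y ∂volume.restrict Ω,
        y ∈ (K : Set (E d)) → x.1 y = MvPolynomial.eval (fun i => y i) (x.2 K : MvPolynomial (Fin d) ℝ)}
      zero_mem' := by
        refine ⟨zero_mem _, fun K => ?_⟩
        filter_upwards [Lp.coeFn_zero ℝ 2 (volume.restrict Ω)] with y hy _
        simpa using hy
      add_mem' := by
        rintro x x' ⟨hx, hx'⟩ ⟨hy, hy'⟩
        refine ⟨add_mem hx hy, fun K => ?_⟩
        filter_upwards [hx' K, hy' K, Lp.coeFn_add x.1 x'.1] with y h1 h2 h3 hK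
        rw [Prod.fst_add, h3, Pi.add_apply, h1 hK, h2 hK]
        simp
      smul_mem' := by
        rintro c x ⟨hx, hx'⟩
        refine ⟨Submodule.smul_mem _ c hx, fun K => ?_⟩
        filter_upwards [hx' K, Lp.coeFn_smul c x.1] with y h1 h3 hK
        simp [h3, h1 hK, MvPolynomial.smul_eval] }
  have hG : FiniteDimensional ℝ G := by
    refine FiniteDimensional.of_injective ((LinearMap.snd ℝ (L2 Ω) _).comp G.subtype) ?_
    rw [injective_iff_map_eq_zero]
    rintro ⟨⟨v, q⟩, hv, hvq⟩ h0
    obtain rfl : q = 0 := h0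
    have : v = 0 := by
      refine Lp.ext ?_
      filter_upwards [ae_all_iff.2 hvq, Lp.coeFn_zero ℝ 2 (volume.restrict Ω),
        ae_restrict_mem hΩ.measurableSet] with y hy h0 hyΩ
      obtain ⟨K, hK, hyK⟩ := T.closure_subset_sUnion_cells (subset_closure hyΩ)
      rw [h0, hy ⟨K, hK⟩ hyK]
      simp
    subst this
    rfl
  refine Module.Finite.of_surjective
    (((LinearMap.fst ℝ (L2 Ω) _).comp G.subtype).codRestrict (T.feSpace k) fun x => x.2.1) ?_
  rintro ⟨v, hv⟩
  choose p hp hpv using hv.2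
  refine ⟨⟨⟨v, fun K => ⟨p K K.2, ?_⟩⟩, hv, fun K => hpv K K.2⟩, rfl⟩
  exact (MvPolynomial.mem_restrictTotalDegree _ _ _).2 (hp K K.2)

end Triangulation

end StabFEM

/-! ### The abstract method and its constants. -/

namespace StabFEM

/-- The properties of a stabilised finite element method that the error analysis uses. The forward
and the adjoint problem enter through the approximability, at the rate `δ`, of the solutions with
data `g`. -/
structure StabilisedMethod {d : ℕ} {Ω : Set (E d)} (V₂ W₂ Vₖ Vh : Submodule ℝ (L2 Ω))
    (ah sa sp : L2 Ω → L2 Ω → ℝ) (πV πW : L2 Ω → L2 Ω) (Nplus Nstar NL : L2 Ω → ℝ)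
    (ca δ ε : ℝ) : Prop where
  bilin : IsBilinOn (V₂ ⊔ Vh) (W₂ ⊔ Vh) ah
  le : Vₖ ≤ V₂
  stab_primal : IsStabilisationOn (Vₖ ⊔ Vh) sp
  stab_dual : IsStabilisationOn Vh sa
  primal_mem : ∀ v ∈ V₂, πV v ∈ Vh
  dual_mem : ∀ w ∈ W₂, πW w ∈ Vh
  forward : ∀ g, ∃ φ ∈ V₂, (∀ w ∈ Vh, ah φ w = inner ℝ g w) ∧
    Nplus (φ - πV φ) ≤ δ * ‖g‖ ∧ stabNorm sp (πV φ) ≤ δ * ‖g‖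
  adjoint : ∀ g, ∃ z ∈ W₂, (∀ v ∈ V₂ ⊔ Vh, ah v z = inner ℝ v g) ∧
    Nstar (z - πW z) ≤ δ * ‖g‖ ∧ stabNorm sa (πW z) ≤ δ * ‖g‖
  nonneg_NL : ∀ v ∈ V₂ ⊔ Vh, 0 ≤ NL v
  continuous_left : ∀ v ∈ V₂, ∀ xh ∈ Vh,
    ah (v - πV v) xh ≤ Nplus (v - πV v) * (ca * stabNorm sa xh + ε * ‖xh‖)
  continuous_right : ∀ v ∈ V₂, ∀ vh ∈ Vh, ∀ y ∈ W₂, ah (v - vh) (y - πW y) ≤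
    Nstar (y - πW y) *
      (ca * NL (v - πV v) + ca * stabNorm sp (vh - πV v) + ε * ‖v - vh‖)
  ca_pos : 0 < ca
  δ_nonneg : 0 ≤ δ
  ε_nonneg : 0 ≤ ε
  small : δ * ε ≤ 1 / 6

/-- `M` bounds the approximation errors of `u`, the solution of the forward problem with
data `f`. -/
structure ApproximatedBy {d : ℕ} {Ω : Set (E d)} (Vₖ Vh : Submodule ℝ (L2 Ω))
    (ah sp : L2 Ω → L2 Ω → ℝ) (πV : L2 Ω → L2 Ω) (Nplus NL : L2 Ω → ℝ) (f u : L2 Ω)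
    (M : ℝ) : Prop where
  mem : u ∈ Vₖ
  consistent : ∀ w ∈ Vh, ah u w = inner ℝ f w
  plus_le : Nplus (u - πV u) ≤ M
  NL_le : NL (u - πV u) ≤ M
  stab_le : stabNorm sp (u - πV u) ≤ M

lemma le_of_sq_le_mul {x c : ℝ} (hc : 0 ≤ c) (h : x ^ 2 ≤ x * c) : x ≤ c := by
  by_contra! hlt
  nlinarith [hc.trans_lt hlt]

/-- The constant of the estimate for the stabilisation seminorms. -/
def stabConst (ca : ℝ) : ℝ := 12 / 5 * (ca + 1) + 1

lemma stabConst_pos {ca : ℝ} (hca : 0 < ca) : 0 < stabConst ca := by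
  rw [stabConst]
  positivity

/-- The constant of the estimate in `L²(Ω)`. -/
def l2Const (ca : ℝ) : ℝ := 6 / 5 * (ca + (ca + 1) * stabConst ca)

lemma l2Const_pos {ca : ℝ} (hca : 0 < ca) : 0 < l2Const ca := by
  have := stabConst_pos hca
  rw [l2Const]
  positivity

/-- The square of the constant of the estimate of the discrete error in `H¹(Ω)`, on a domain of
diameter `D`. -/
def h1ConstSq (cΩ ci ca cγ cG lam D : ℝ) : ℝ :=
  |lam| * ((l2Const ca * (cγ * cΩ) * cγ + ci) * D) ^ 2 +
    cG * ((2 * stabConst ca ^ 2 + ca * stabConst ca) * cγ ^ 2 +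
      (l2Const ca * (cγ * cΩ) * cγ + ci) / (6 * cΩ))

/-! ### A priori estimates, unique solvability and the discrete `H¹` error. -/

namespace StabilisedMethod

variable {d : ℕ} {Ω : Set (E d)} {V₂ W₂ Vₖ Vh : Submodule ℝ (L2 Ω)}
  {ah sa sp : L2 Ω → L2 Ω → ℝ} {πV πW : L2 Ω → L2 Ω} {Nplus Nstar NL : L2 Ω → ℝ}
  {ca δ ε : ℝ} {f u uh zh : L2 Ω} {M : ℝ}

/-- The dual variable is controlled by the stabilisation. -/
lemma norm_dual_le (S : StabilisedMethod V₂ W₂ Vₖ Vh ah sa sp πV πW Nplus Nstar NL ca δ ε)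
    (hM : ApproximatedBy Vₖ Vh ah sp πV Nplus NL f u M)
    (hh : SolvesFEM Vh ah sa sp f u uh zh) :
    ‖zh‖ ≤ δ * (ca * stabNorm sa zh + ε * ‖zh‖ + (stabNorm sp (uh - πV u) + M)) := by
  have hca := S.ca_pos
  have hε := S.ε_nonneg
  have hu₂ := S.le hM.mem
  have hle : Vh ≤ Vₖ ⊔ Vh := le_sup_right
  have hV : V₂ ≤ V₂ ⊔ Vh := le_sup_left
  have hV' : Vh ≤ V₂ ⊔ Vh := le_sup_right
  have hW' : Vh ≤ W₂ ⊔ Vh := le_sup_right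
  have huk : u ∈ Vₖ ⊔ Vh := Submodule.mem_sup_left hM.mem
  have hπ := S.primal_mem u hu₂
  have hM0 : 0 ≤ M := (stabNorm_nonneg _ _).trans hM.stab_le
  have ha := stabNorm_nonneg sa zh
  have hp := stabNorm_nonneg sp (uh - πV u)
  -- Duality: `‖zh‖ ^ 2 = ah φ zh = ah (φ - πV φ) zh + sp (uh - u) (πV φ)`, the last term by the
  -- dual equation tested with `πV φ`.
  obtain ⟨φ, hφ, hφh, hN, hs⟩ := S.forward zh
  have hπφ := S.primal_mem φ hφ
  refine le_of_sq_le_mul (mul_nonneg S.δ_nonneg (by positivity)) ?_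
  have h1 : ah (φ - πV φ) zh = inner ℝ zh zh - ah (πV φ) zh := by
    rw [S.bilin.sub_left (hV hφ) (hV' hπφ) (hW' hh.dual_mem), hφh zh hh.dual_mem]
  have h2 := hh.dual _ hπφ
  have h3 : sp (uh - πV u) (πV φ) = sp uh (πV φ) - sp (πV u) (πV φ) :=
    S.stab_primal.bilin.sub_left (hle hh.primal_mem) (hle hπ) (hle hπφ)
  have h4 : sp (u - πV u) (πV φ) = sp u (πV φ) - sp (πV u) (πV φ) :=
    S.stab_primal.bilin.sub_left huk (hle hπ) (hle hπφ)
  have h5 := S.stab_primal.le (sub_mem (hle hh.primal_mem) (hle hπ)) (hle hπφ)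
  have h6 := S.stab_primal.neg_le (sub_mem huk (hle hπ)) (hle hπφ)
  have h7 := S.continuous_left φ hφ zh hh.dual_mem
  rw [real_inner_self_eq_norm_sq] at h1
  have h8 := mul_le_mul_of_nonneg_right hN
    (show 0 ≤ ca * stabNorm sa zh + ε * ‖zh‖ by positivity)
  have h9 := mul_le_mul_of_nonneg_left hs hp
  have h10 : stabNorm sp (u - πV u) * stabNorm sp (πV φ) ≤ M * (δ * ‖zh‖) :=
    mul_le_mul hM.stab_le hs (stabNorm_nonneg _ _) hM0
  linarith

/-- The stabilisation seminorms of the discrete errors. -/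
lemma stabNorm_add_le (S : StabilisedMethod V₂ W₂ Vₖ Vh ah sa sp πV πW Nplus Nstar NL ca δ ε)
    (hM : ApproximatedBy Vₖ Vh ah sp πV Nplus NL f u M)
    (hh : SolvesFEM Vh ah sa sp f u uh zh) :
    stabNorm sp (uh - πV u) + stabNorm sa zh ≤ stabConst ca * M := by
  have hca := S.ca_pos
  have hε := S.ε_nonneg
  have hu₂ := S.le hM.mem
  have hle : Vh ≤ Vₖ ⊔ Vh := le_sup_right
  have hV' : Vh ≤ V₂ ⊔ Vh := le_sup_right
  have hW' : Vh ≤ W₂ ⊔ Vh := le_sup_right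
  have huk : u ∈ Vₖ ⊔ Vh := Submodule.mem_sup_left hM.mem
  have hπ := S.primal_mem u hu₂
  have hξ := sub_mem hh.primal_mem hπ
  have hM0 : 0 ≤ M := (stabNorm_nonneg _ _).trans hM.stab_le
  have hz := S.norm_dual_le hM hh
  have e1 : sp (uh - πV u) (uh - πV u) = sp uh (uh - πV u) - sp (πV u) (uh - πV u) :=
    S.stab_primal.bilin.sub_left (hle hh.primal_mem) (hle hπ) (hle hξ)
  have e2 : sp (u - πV u) (uh - πV u) = sp u (uh - πV u) - sp (πV u) (uh - πV u) :=
    S.stab_primal.bilin.sub_left huk (hle hπ) (hle hξ)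
  have e3 := S.stab_primal.le (sub_mem huk (hle hπ)) (hle hξ)
  have e4 := hh.dual _ hξ
  have e5 := hh.primal _ hh.dual_mem
  have e6 : ah (uh - πV u) zh = ah uh zh - ah (πV u) zh :=
    S.bilin.sub_left (hV' hh.primal_mem) (hV' hπ) (hW' hh.dual_mem)
  have e7 : ah (u - πV u) zh = ah u zh - ah (πV u) zh :=
    S.bilin.sub_left (Submodule.mem_sup_left hu₂) (hV' hπ) (hW' hh.dual_mem)
  have e8 := hM.consistent zh hh.dual_mem
  have e9 := S.continuous_left u hu₂ zh hh.dual_mem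
  have e10 := S.stab_primal.sq_stabNorm (hle hξ)
  have e11 := S.stab_dual.sq_stabNorm hh.dual_mem
  have ha := stabNorm_nonneg sa zh
  have hp := stabNorm_nonneg sp (uh - πV u)
  have e12 := mul_le_mul_of_nonneg_right hM.plus_le
    (show 0 ≤ ca * stabNorm sa zh + ε * ‖zh‖ by positivity)
  have e13 := mul_le_mul_of_nonneg_right hM.stab_le hp
  set p := stabNorm sp (uh - πV u)
  set a := stabNorm sa zh
  -- `norm_dual_le` times `ε`, with `δ * ε ≤ 1 / 6`; absorbing `ε * ‖zh‖` turns `1 / 6` into `1 /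
  -- 5`.
  have hεz : ε * ‖zh‖ ≤ 1 / 5 * (ca * a + p + M) := by
    have h1 := mul_le_mul_of_nonneg_left hz hε
    have h2 := mul_le_mul_of_nonneg_right S.small
      (show 0 ≤ ca * a + ε * ‖zh‖ + (p + M) by positivity)
    linarith
  have e14 := mul_le_mul_of_nonneg_left hεz hM0
  have hsq : p ^ 2 + a ^ 2 ≤ M * (6 / 5 * (ca + 1) * (p + a) + M / 5) := by
    have h1 : 0 ≤ M * (ca * p) := by positivity
    have h2 : 0 ≤ M * a := by positivity
    linarith
  -- If the bound fails then `M ≤ p + a`, so `(p + a) ^ 2 ≤ 2 * (p ^ 2 + a ^ 2)` is at most `(12 / 5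
  -- * (ca + 1) + 2 / 5) * M * (p + a)`. The summand `1` in `stabConst` dominates `2 / 5`.
  by_contra! hlt
  have hK : 0 ≤ stabConst ca * M := mul_nonneg (stabConst_pos hca).le hM0
  rw [stabConst] at hlt hK
  have hx : 0 < p + a := hK.trans_lt hlt
  have h1 := mul_lt_mul_of_pos_right hlt hx
  have h2 : M * M ≤ M * (p + a) := by
    refine mul_le_mul_of_nonneg_left ?_ hM0
    have : 0 ≤ ca * M := by positivity
    linarith
  nlinarith [sq_nonneg (p - a), mul_nonneg hM0 hx.le]

/-- The error in `L²(Ω)`, by duality. -/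
lemma norm_error_le (S : StabilisedMethod V₂ W₂ Vₖ Vh ah sa sp πV πW Nplus Nstar NL ca δ ε)
    (hM : ApproximatedBy Vₖ Vh ah sp πV Nplus NL f u M)
    (hh : SolvesFEM Vh ah sa sp f u uh zh) :
    ‖u - uh‖ ≤ l2Const ca * δ * M := by
  have hca := S.ca_pos
  have hε := S.ε_nonneg
  have hδ := S.δ_nonneg
  have hu₂ := S.le hM.mem
  have hV : V₂ ≤ V₂ ⊔ Vh := le_sup_left
  have hV' : Vh ≤ V₂ ⊔ Vh := le_sup_right
  have hW' : Vh ≤ W₂ ⊔ Vh := le_sup_right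
  have hπ := S.primal_mem u hu₂
  have hM0 : 0 ≤ M := (stabNorm_nonneg _ _).trans hM.stab_le
  have hst := S.stabNorm_add_le hM hh
  have ha := stabNorm_nonneg sa zh
  have hp := stabNorm_nonneg sp (uh - πV u)
  have hNL := S.nonneg_NL _ (sub_mem (hV hu₂) (hV' hπ))
  -- With `e = u - uh`: `‖e‖ ^ 2 = ah e (z - πW z) + ah e (πW z)`, and `ah e (πW z) = sa zh (πW z)`
  -- by consistency and the primal equation.
  obtain ⟨z, hz, hzh, hN, hs⟩ := S.adjoint (u - uh)
  have hπz := S.dual_mem z hz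
  have he := sub_mem (hV hu₂) (hV' hh.primal_mem)
  have h1 := hzh _ he
  rw [real_inner_self_eq_norm_sq] at h1
  have h2 := S.bilin.sub_right he (Submodule.mem_sup_left hz) (hW' hπz)
  have h3 := S.bilin.sub_left (hV hu₂) (hV' hh.primal_mem) (hW' hπz)
  have h4 := hM.consistent _ hπz
  have h5 := hh.primal _ hπz
  have h6 := S.stab_dual.le hh.dual_mem hπz
  have h7 := S.continuous_right u hu₂ uh hh.primal_mem z hz
  have h8 := mul_le_mul_of_nonneg_right hN (show 0 ≤ ca * NL (u - πV u) +
    ca * stabNorm sp (uh - πV u) + ε * ‖u - uh‖ by positivity)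
  have h9 := mul_le_mul_of_nonneg_left hs ha
  have h10 := mul_le_mul_of_nonneg_left hM.NL_le hca.le
  set p := stabNorm sp (uh - πV u)
  set a := stabNorm sa zh
  have key : ‖u - uh‖ ≤ δ * (ca * NL (u - πV u) + ca * p + ε * ‖u - uh‖ + a) := by
    refine le_of_sq_le_mul (by positivity) ?_
    linarith
  -- Absorbs `δ * ε * ‖u - uh‖`; this is the factor `6 / 5` in `l2Const`.
  have h11 := mul_le_mul_of_nonneg_right S.small (norm_nonneg (u - uh))
  have h12 : ca * NL (u - πV u) + ca * p + a ≤ ca * M + (ca + 1) * (stabConst ca * M) := by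
    have := mul_le_mul_of_nonneg_left hst (show 0 ≤ ca + 1 by positivity)
    have h : 0 ≤ ca * a := by positivity
    linarith
  have h13 := mul_le_mul_of_nonneg_left h12 hδ
  rw [l2Const]
  linarith

/-- Stability and consistency bound the form and the stabilisation at the discrete error. -/
lemma form_discreteError_le
    (S : StabilisedMethod V₂ W₂ Vₖ Vh ah sa sp πV πW Nplus Nstar NL ca δ ε)
    (hsa : ∀ v ∈ Vh, ∀ w ∈ Vh, sa v w = sp v w)
    (hM : ApproximatedBy Vₖ Vh ah sp πV Nplus NL f u M)
    (hh : SolvesFEM Vh ah sa sp f u uh zh) :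
    ah (uh - πV u) (uh - πV u) + sp (uh - πV u) (uh - πV u) ≤
      (2 * stabConst ca ^ 2 + ca * stabConst ca) * M ^ 2 + M * (ε * ‖uh - πV u‖) := by
  have hca := S.ca_pos
  have hε := S.ε_nonneg
  have hu₂ := S.le hM.mem
  have hle : Vh ≤ Vₖ ⊔ Vh := le_sup_right
  have hV' : Vh ≤ V₂ ⊔ Vh := le_sup_right
  have hW' : Vh ≤ W₂ ⊔ Vh := le_sup_right
  have hπ := S.primal_mem u hu₂
  have hξ := sub_mem hh.primal_mem hπ
  have hM0 : 0 ≤ M := (stabNorm_nonneg _ _).trans hM.stab_le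
  have hst := S.stabNorm_add_le hM hh
  -- The primal equation tested with `ξ` produces its `sa`-seminorm, while `stabNorm_add_le`
  -- controls only the `sp`-seminorm of `ξ`.
  have e1 : stabNorm sa (uh - πV u) = stabNorm sp (uh - πV u) := by
    rw [stabNorm, stabNorm, hsa _ hξ _ hξ]
  have e2 := hh.primal _ hξ
  have e3 := hM.consistent _ hξ
  have e4 : ah (uh - πV u) (uh - πV u) = ah uh (uh - πV u) - ah (πV u) (uh - πV u) :=
    S.bilin.sub_left (hV' hh.primal_mem) (hV' hπ) (hW' hξ)
  have e5 : ah (u - πV u) (uh - πV u) = ah u (uh - πV u) - ah (πV u) (uh - πV u) :=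
    S.bilin.sub_left (Submodule.mem_sup_left hu₂) (hV' hπ) (hW' hξ)
  have e6 := S.continuous_left u hu₂ _ hξ
  have e7 := S.stab_dual.neg_le hh.dual_mem hξ
  have e8 := S.stab_primal.sq_stabNorm (hle hξ)
  rw [e1] at e6 e7
  have ha := stabNorm_nonneg sa zh
  have hp := stabNorm_nonneg sp (uh - πV u)
  have e9 := mul_le_mul_of_nonneg_right hM.plus_le
    (show 0 ≤ ca * stabNorm sp (uh - πV u) + ε * ‖uh - πV u‖ by positivity)
  set p := stabNorm sp (uh - πV u)
  set a := stabNorm sa zh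
  have hK : 0 ≤ stabConst ca * M := by linarith
  have hp' : p ≤ stabConst ca * M := by linarith
  have ha' : a ≤ stabConst ca * M := by linarith
  have e10 : p ^ 2 ≤ (stabConst ca * M) ^ 2 := pow_le_pow_left₀ hp hp' 2
  have e11 : a * p ≤ stabConst ca * M * (stabConst ca * M) := mul_le_mul ha' hp' hp hK
  have e12 := mul_le_mul_of_nonneg_left hp' (show 0 ≤ M * ca by positivity)
  linarith

/-- For `M = 0` the `L²` estimate kills `uh`, and both stabilisation seminorms vanish; then
`norm_dual_le` reads `‖zh‖ ≤ δ * ε * ‖zh‖ ≤ ‖zh‖ / 6`. -/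
lemma eq_zero_of_approximatedBy_zero
    (S : StabilisedMethod V₂ W₂ Vₖ Vh ah sa sp πV πW Nplus Nstar NL ca δ ε)
    (hM : ApproximatedBy Vₖ Vh ah sp πV Nplus NL 0 0 0)
    (hh : SolvesFEM Vh ah sa sp 0 0 uh zh) : uh = 0 ∧ zh = 0 := by
  have h1 := S.norm_error_le hM hh
  rw [mul_zero, zero_sub, norm_neg] at h1
  have h2 := S.stabNorm_add_le hM hh
  have h3 := S.norm_dual_le hM hh
  have ha := stabNorm_nonneg sa zh
  have hp := stabNorm_nonneg sp (uh - πV 0)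
  have ha0 : stabNorm sa zh = 0 := by linarith
  have hp0 : stabNorm sp (uh - πV 0) = 0 := by linarith
  rw [ha0, hp0] at h3
  have h4 := mul_le_mul_of_nonneg_right S.small (norm_nonneg zh)
  exact ⟨norm_le_zero_iff.1 h1, norm_le_zero_iff.1 (by linarith)⟩

/-- Existence for the square linear system, from uniqueness. -/
lemma exists_solvesFEM [FiniteDimensional ℝ Vh]
    (S : StabilisedMethod V₂ W₂ Vₖ Vh ah sa sp πV πW Nplus Nstar NL ca δ ε)
    (h0 : ApproximatedBy Vₖ Vh ah sp πV Nplus NL 0 0 0) (hu : u ∈ Vₖ) (f : L2 Ω) :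
    ∃ uh zh, SolvesFEM Vh ah sa sp f u uh zh := by
  have hle : Vh ≤ Vₖ ⊔ Vh := le_sup_right
  have huk : u ∈ Vₖ ⊔ Vh := Submodule.mem_sup_left hu
  let A := (S.bilin.mono (A' := Vh) (B' := Vh) le_sup_right le_sup_right).toBilin
  let P := (S.stab_primal.mono hle).bilin.toBilin
  let D := S.stab_dual.bilin.toBilin
  -- The block operator `[[A, D], [-P, Aᵀ]]` of the system, between spaces of equal dimension.
  let L : Vh × Vh →ₗ[ℝ] Module.Dual ℝ Vh × Module.Dual ℝ Vh :=
    (A.coprod D).prod ((-P).coprod A.flip)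
  have hL : ∀ x, L x = (A x.1 + D x.2, -P x.1 + A.flip x.2) := fun x => rfl
  have hinj : Function.Injective L := by
    rw [injective_iff_map_eq_zero]
    rintro ⟨x, y⟩ hxy
    rw [hL, Prod.mk_eq_zero] at hxy
    have hs : SolvesFEM Vh ah sa sp 0 0 x y := by
      refine ⟨x.2, y.2, fun w hw => ?_, fun v hv => ?_⟩
      · rw [inner_zero_left]
        exact LinearMap.congr_fun hxy.1 ⟨w, hw⟩
      · have h := LinearMap.congr_fun hxy.2 ⟨v, hv⟩
        have h' : -sp x v + ah v y = 0 := h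
        rw [S.stab_primal.bilin.zero_left (hle hv)]
        linarith
    obtain ⟨hx, hy⟩ := S.eq_zero_of_approximatedBy_zero h0 hs
    exact Prod.ext (Subtype.ext hx) (Subtype.ext hy)
  have hsurj : Function.Surjective L :=
    (LinearMap.injective_iff_surjective_of_finrank_eq_finrank (by
      simp [Module.finrank_prod, Subspace.dual_finrank_eq])).1 hinj
  let F : Module.Dual ℝ Vh := (innerₛₗ ℝ f).comp Vh.subtype
  let R : Module.Dual ℝ Vh := (S.stab_primal.bilin.toBilin ⟨u, huk⟩).comp (Submodule.inclusion hle)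
  obtain ⟨⟨x, y⟩, hxy⟩ := hsurj (F, -R)
  rw [hL, Prod.mk_inj] at hxy
  refine ⟨x, y, x.2, y.2, fun w hw => ?_, fun v hv => ?_⟩
  · exact LinearMap.congr_fun hxy.1 ⟨w, hw⟩
  · have h : -sp x v + ah v y = -sp u v := LinearMap.congr_fun hxy.2 ⟨v, hv⟩
    linarith

lemma solvesFEM_unique
    (S : StabilisedMethod V₂ W₂ Vₖ Vh ah sa sp πV πW Nplus Nstar NL ca δ ε)
    (h0 : ApproximatedBy Vₖ Vh ah sp πV Nplus NL 0 0 0) {uh' zh' : L2 Ω}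
    (hh : SolvesFEM Vh ah sa sp f u uh zh) (hh' : SolvesFEM Vh ah sa sp f u uh' zh') :
    uh' = uh ∧ zh' = zh := by
  have hle : Vh ≤ Vₖ ⊔ Vh := le_sup_right
  have hb := S.bilin.mono (A' := Vh) (B' := Vh) le_sup_right le_sup_right
  have hs : SolvesFEM Vh ah sa sp 0 0 (uh' - uh) (zh' - zh) := by
    refine ⟨sub_mem hh'.1 hh.1, sub_mem hh'.2 hh.2, fun w hw => ?_, fun v hv => ?_⟩
    · rw [hb.sub_left hh'.1 hh.1 hw, S.stab_dual.bilin.sub_left hh'.2 hh.2 hw, inner_zero_left]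
      linarith [hh.primal w hw, hh'.primal w hw]
    · rw [hb.sub_right hv hh'.2 hh.2,
        S.stab_primal.bilin.sub_left (hle hh'.1) (hle hh.1) (hle hv),
        S.stab_primal.bilin.zero_left (hle hv)]
      linarith [hh.dual v hv, hh'.dual v hv]
  obtain ⟨h1, h2⟩ := S.eq_zero_of_approximatedBy_zero h0 hs
  exact ⟨sub_eq_zero.1 h1, sub_eq_zero.1 h2⟩

/-- The discrete error in `H¹(Ω)` for approximation errors of order `Y`, from the Gårding
inequality. -/
lemma gradNorm_discreteError_le {cΩ ci cγ cG lam h D Y : ℝ}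
    (S : StabilisedMethod V₂ W₂ Vₖ Vh ah sa sp πV πW Nplus Nstar NL ca (cγ * cΩ * h) ε)
    (hsa : ∀ v ∈ Vh, ∀ w ∈ Vh, sa v w = sp v w)
    (hcΩ : 0 < cΩ) (hci : 0 < ci) (hcγ : 0 < cγ) (hcG : 0 < cG) (hh0 : 0 < h) (hhD : h ≤ D)
    (hY : 0 ≤ Y)
    (hG : ∀ vh ∈ Vh, gradNorm Ω vh ^ 2 - lam * ‖vh‖ ^ 2 ≤ cG * (ah vh vh + sp vh vh))
    (hM : ApproximatedBy Vₖ Vh ah sp πV Nplus NL f u (cγ * Y))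
    (hi : ‖u - πV u‖ ≤ ci * (h * Y)) (hh : SolvesFEM Vh ah sa sp f u uh zh) :
    gradNorm Ω (uh - πV u) ≤ √(h1ConstSq cΩ ci ca cγ cG lam D) * Y := by
  have hξ := sub_mem hh.primal_mem (S.primal_mem u (S.le hM.mem))
  have hL := l2Const_pos S.ca_pos
  set K := l2Const ca * (cγ * cΩ) * cγ + ci with hK
  have hK0 : 0 < K := by positivity
  have hx : ‖uh - πV u‖ ≤ K * (h * Y) := by
    have h1 := norm_sub_le (u - πV u) (u - uh)
    rw [sub_sub_sub_cancel_left] at h1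
    have h2 := S.norm_error_le hM hh
    rw [hK]
    linarith
  have hx2 : lam * ‖uh - πV u‖ ^ 2 ≤ |lam| * (K * (D * Y)) ^ 2 := by
    refine mul_le_mul (le_abs_self _) (pow_le_pow_left₀ (norm_nonneg _) (hx.trans ?_) 2)
      (sq_nonneg _) (abs_nonneg _)
    gcongr
  -- The factor `ε` has no bound of its own; the `h` in `hx` completes it to `cγ * cΩ * h * ε ≤ 1 /
  -- 6`, at the price of dividing by `cΩ`.
  have hεx : cγ * Y * (ε * ‖uh - πV u‖) ≤ K / (6 * cΩ) * Y ^ 2 := by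
    have h1 := mul_le_mul_of_nonneg_left hx
      (show 0 ≤ cγ * Y * ε from mul_nonneg (by positivity) S.ε_nonneg)
    have h2 := mul_le_mul_of_nonneg_right S.small (show 0 ≤ K / cΩ * Y ^ 2 by positivity)
    calc cγ * Y * (ε * ‖uh - πV u‖) ≤ cγ * Y * ε * (K * (h * Y)) := by linarith
      _ = cγ * cΩ * h * ε * (K / cΩ * Y ^ 2) := by field_simp
      _ ≤ 1 / 6 * (K / cΩ * Y ^ 2) := h2
      _ = K / (6 * cΩ) * Y ^ 2 := by field_simp
  have h3 := mul_le_mul_of_nonneg_left (S.form_discreteError_le hsa hM hh) hcG.le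
  have h4 := mul_le_mul_of_nonneg_left hεx hcG.le
  have h5 := hG _ hξ
  have h6 : gradNorm Ω (uh - πV u) ^ 2 ≤ h1ConstSq cΩ ci ca cγ cG lam D * Y ^ 2 := by
    rw [h1ConstSq, ← hK]
    linarith
  calc gradNorm Ω (uh - πV u) ≤ √(h1ConstSq cΩ ci ca cγ cG lam D * Y ^ 2) := Real.le_sqrt_of_sq_le h6
    _ = √(h1ConstSq cΩ ci ca cγ cG lam D) * Y := by
      rw [Real.sqrt_mul' _ (sq_nonneg Y), Real.sqrt_sq hY]

end StabilisedMethod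

end StabFEM

end

/-! ### Verification of the abstract hypotheses and the final estimate. -/

theorem mainTheorem12 (d : ℕ) (hd : d = 2 ∨ d = 3) (Ω : Set (StabFEM.E d))
    (hΩ : IsOpen Ω) (hΩne : Ω.Nonempty) (k : ℕ) (hk : 1 ≤ k)
    -- constants of the smoothing property, interpolation, continuity, approximation and
    -- Gårding inequalities; they are fixed before the forms, the mesh and the solution
    (cΩ ci ca cγ cG lam : ℝ)
    (hcΩ : 0 < cΩ) (hci : 0 < ci) (hca : 0 < ca) (hcγ : 0 < cγ) (hcG : 0 < cG) :
    ∃ C : ℝ, 0 < C ∧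
      ∀ (V W : Submodule ℝ (StabFEM.L2 Ω)) (a : StabFEM.L2 Ω → StabFEM.L2 Ω → ℝ),
      V ≤ StabFEM.sobolev Ω 1 → W ≤ StabFEM.sobolev Ω 1 → StabFEM.IsBilinOn V W a →
      -- well-posedness of the forward and the adjoint problem
      (∀ f : StabFEM.L2 Ω, ∃! u, StabFEM.SolvesForward V W a f u) →
      (∀ g : StabFEM.L2 Ω, ∃! z, StabFEM.SolvesAdjoint V W a g z) →
      -- smoothing property
      (∀ f u, StabFEM.SolvesForward V W a f u →
        u ∈ StabFEM.sobolev Ω 2 ∧ StabFEM.seminormH Ω 2 u ≤ cΩ * ‖f‖) →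
      (∀ g z, StabFEM.SolvesAdjoint V W a g z →
        z ∈ StabFEM.sobolev Ω 2 ∧ StabFEM.seminormH Ω 2 z ≤ cΩ * ‖g‖) →
      -- the mesh (neither shape regular nor quasi-uniform), the discrete space and its mesh size
      ∀ (T : StabFEM.Triangulation Ω) (Vh : Submodule ℝ (StabFEM.L2 Ω)) (h : ℝ),
      Vh ≤ T.feSpace k → h = T.meshSize →
      -- the discrete forms, interpolation operators, seminorms, and the number `ε = ε(h)`
      ∀ (ah sa sp : StabFEM.L2 Ω → StabFEM.L2 Ω → ℝ) (πV πW : StabFEM.L2 Ω → StabFEM.L2 Ω)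
        (Nplus Nstar NL : StabFEM.L2 Ω → ℝ) (ε : ℝ),
      StabFEM.IsBilinOn ((V ⊓ StabFEM.sobolev Ω 2) ⊔ Vh) ((W ⊓ StabFEM.sobolev Ω 2) ⊔ Vh) ah →
      StabFEM.IsStabilisationOn ((V ⊓ StabFEM.sobolev Ω (k + 1)) ⊔ Vh) sp →
      StabFEM.IsStabilisationOn ((W ⊓ StabFEM.sobolev Ω (k + 1)) ⊔ Vh) sa →
      StabFEM.IsSeminormOn ((V ⊓ StabFEM.sobolev Ω 2) ⊔ Vh) Nplus →
      StabFEM.IsSeminormOn ((W ⊓ StabFEM.sobolev Ω 2) ⊔ Vh) Nstar →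
      StabFEM.IsSeminormOn ((V ⊓ StabFEM.sobolev Ω 2) ⊔ Vh) NL →
      (∀ v ∈ V ⊓ StabFEM.sobolev Ω 2, πV v ∈ Vh) →
      (∀ w ∈ W ⊓ StabFEM.sobolev Ω 2, πW w ∈ Vh) →
      0 ≤ ε →
      -- strong consistency
      (∀ f u, StabFEM.SolvesForward V W a f u →
        ∀ φ ∈ (W ⊓ StabFEM.sobolev Ω 2) ⊔ Vh, ah u φ = inner ℝ f φ) →
      (∀ g z, StabFEM.SolvesAdjoint V W a g z →
        ∀ φ ∈ (V ⊓ StabFEM.sobolev Ω 2) ⊔ Vh, ah φ z = inner ℝ φ g) →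
      -- interpolation estimates
      (∀ v ∈ V ⊓ StabFEM.sobolev Ω (k + 1),
        ‖v - πV v‖ + h * StabFEM.gradNorm Ω (v - πV v)
          ≤ ci * h ^ (k + 1) * StabFEM.seminormH Ω (k + 1) v) →
      (∀ w ∈ W ⊓ StabFEM.sobolev Ω (k + 1),
        ‖w - πW w‖ + h * StabFEM.gradNorm Ω (w - πW w)
          ≤ ci * h ^ (k + 1) * StabFEM.seminormH Ω (k + 1) w) →
      -- continuity relations
      (∀ v ∈ V ⊓ StabFEM.sobolev Ω 2, ∀ xh ∈ Vh,
        ah (v - πV v) xh ≤ Nplus (v - πV v) * (ca * StabFEM.stabNorm sa xh + ε * ‖xh‖)) →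
      (∀ v ∈ V ⊓ StabFEM.sobolev Ω 2, ∀ vh ∈ Vh, ∀ y ∈ W ⊓ StabFEM.sobolev Ω 2,
        ah (v - vh) (y - πW y) ≤ Nstar (y - πW y) *
          (ca * NL (v - πV v) + ca * StabFEM.stabNorm sp (vh - πV v) + ε * ‖v - vh‖)) →
      -- approximation estimates of order `k`
      (∀ v ∈ V ⊓ StabFEM.sobolev Ω (k + 1),
        NL (v - πV v) + Nplus (v - πV v) + StabFEM.stabNorm sp (v - πV v)
          ≤ cγ * h ^ k * StabFEM.seminormH Ω (k + 1) v) →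
      (∀ w ∈ W ⊓ StabFEM.sobolev Ω (k + 1),
        Nstar (w - πW w) + StabFEM.stabNorm sa (w - πW w)
          ≤ cγ * h ^ k * StabFEM.seminormH Ω (k + 1) w) →
      -- first order approximation of `H²` functions
      (∀ v ∈ V ⊓ StabFEM.sobolev Ω 2, Nplus (v - πV v) ≤ cγ * h * StabFEM.seminormH Ω 2 v) →
      (∀ w ∈ W ⊓ StabFEM.sobolev Ω 2, Nstar (w - πW w) ≤ cγ * h * StabFEM.seminormH Ω 2 w) →
      -- upper bounds for the stabilisation of interpolants
      (∀ w ∈ W ⊓ StabFEM.sobolev Ω 2,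
        StabFEM.stabNorm sa (πW w) ≤ cγ * h * StabFEM.seminormH Ω 2 w) →
      (∀ v ∈ V ⊓ StabFEM.sobolev Ω 2,
        StabFEM.stabNorm sp (πV v) ≤ cγ * h * StabFEM.seminormH Ω 2 v) →
      -- smallness of `h ε(h)`
      cγ * cΩ * h * ε ≤ 1 / 6 →
      -- Gårding inequality, and equality of the two stabilisations
      (∀ vh ∈ Vh, StabFEM.gradNorm Ω vh ^ 2 - lam * ‖vh‖ ^ 2 ≤ cG * (ah vh vh + sp vh vh)) →
      (∀ vh ∈ Vh, ∀ wh ∈ Vh, sa vh wh = sp vh wh) →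
      ∀ f u, StabFEM.SolvesForward V W a f u → u ∈ StabFEM.sobolev Ω (k + 1) →
        ∃ uh zh, StabFEM.SolvesFEM Vh ah sa sp f u uh zh ∧
          (∀ uh' zh', StabFEM.SolvesFEM Vh ah sa sp f u uh' zh' → uh' = uh ∧ zh' = zh) ∧
          StabFEM.gradNorm Ω (u - uh) ≤ C * h ^ k * StabFEM.seminormH Ω (k + 1) u := by
  have hd0 : 0 < d := by omega
  -- Interpolation error plus discrete error; `Ω` enters through its diameter, and `ci > 0` makes
  -- the sum positive.
  refine ⟨ci + √(StabFEM.h1ConstSq cΩ ci ca cγ cG lam (Metric.diam (closure Ω))), by positivity, ?_⟩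
  intro V W a hV hW ha hfw had hfreg hareg T Vh h hVh hh ah sa sp πV πW Nplus Nstar NL ε hah hsp hsa
    hNplus hNstar hNL hπV hπW hε hcons hconsa hiV hiW hcl hcr happ happ' hN1 hN2 hub1 hub2 hsmall
    hgard hsasp f u hu huk
  have hh0 : 0 < h := hh ▸ T.meshSize_pos hd0 hΩne
  have hhD : h ≤ Metric.diam (closure Ω) := hh ▸ T.meshSize_le_diam
  have hle : V ⊓ StabFEM.sobolev Ω (k + 1) ≤ V ⊓ StabFEM.sobolev Ω 2 :=
    inf_le_inf_left V (StabFEM.sobolev_anti (by omega))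
  have hscale : ∀ {x y : ℝ}, x ≤ cΩ * y → cγ * h * x ≤ cγ * cΩ * h * y := fun hxy =>
    (mul_le_mul_of_nonneg_left hxy (by positivity)).trans_eq (by ring)
  have S : StabFEM.StabilisedMethod (V ⊓ StabFEM.sobolev Ω 2) (W ⊓ StabFEM.sobolev Ω 2)
      (V ⊓ StabFEM.sobolev Ω (k + 1)) Vh ah sa sp πV πW Nplus Nstar NL ca (cγ * cΩ * h) ε :=
    { bilin := hah
      le := hle
      stab_primal := hsp
      stab_dual := hsa.mono le_sup_right
      primal_mem := hπV
      dual_mem := hπW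
      forward := fun g => by
        obtain ⟨φ, hφ, -⟩ := hfw g
        obtain ⟨h2, hreg⟩ := hfreg g φ hφ
        exact ⟨φ, ⟨hφ.1, h2⟩, fun w hw => hcons g φ hφ w (Submodule.mem_sup_right hw),
          (hN1 φ ⟨hφ.1, h2⟩).trans (hscale hreg), (hub2 φ ⟨hφ.1, h2⟩).trans (hscale hreg)⟩
      adjoint := fun g => by
        obtain ⟨z, hz, -⟩ := had g
        obtain ⟨h2, hreg⟩ := hareg g z hz
        exact ⟨z, ⟨hz.1, h2⟩, hconsa g z hz,
          (hN2 z ⟨hz.1, h2⟩).trans (hscale hreg), (hub1 z ⟨hz.1, h2⟩).trans (hscale hreg)⟩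
      nonneg_NL := hNL.nonneg
      continuous_left := hcl
      continuous_right := hcr
      ca_pos := hca
      δ_nonneg := by positivity
      ε_nonneg := hε
      small := hsmall }
  have happrox : ∀ f u, StabFEM.SolvesForward V W a f u → u ∈ StabFEM.sobolev Ω (k + 1) →
      StabFEM.ApproximatedBy (V ⊓ StabFEM.sobolev Ω (k + 1)) Vh ah sp πV Nplus NL f u
        (cγ * (h ^ k * StabFEM.seminormH Ω (k + 1) u)) := fun f u hu huk => by
    have hu₂ := hle ⟨hu.1, huk⟩
    have hmem : u - πV u ∈ (V ⊓ StabFEM.sobolev Ω 2) ⊔ Vh :=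
      sub_mem (Submodule.mem_sup_left hu₂) (Submodule.mem_sup_right (hπV u hu₂))
    have h1 := happ u ⟨hu.1, huk⟩
    rw [mul_assoc] at h1
    have h2 := hNL.nonneg _ hmem
    have h3 := hNplus.nonneg _ hmem
    have h4 := StabFEM.stabNorm_nonneg sp (u - πV u)
    exact ⟨⟨hu.1, huk⟩, fun w hw => hcons f u hu w (Submodule.mem_sup_right hw),
      by linarith, by linarith, by linarith⟩
  -- `πV` is not assumed linear, so `πV 0` is handled by the approximation estimates for the zero
  -- solution.
  have h0 : StabFEM.ApproximatedBy (V ⊓ StabFEM.sobolev Ω (k + 1)) Vh ah sp πV Nplus NL 0 0 0 := by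
    have hs : StabFEM.SolvesForward V W a 0 0 :=
      ⟨zero_mem _, fun w hw => by rw [ha.zero_left hw, inner_zero_left]⟩
    simpa [StabFEM.seminormH_zero hΩ] using happrox 0 0 hs (zero_mem _)
  have := T.finiteDimensional_feSpace hΩ k
  have : FiniteDimensional ℝ Vh := Submodule.finiteDimensional_of_le hVh
  obtain ⟨uh, zh, hFEM⟩ := S.exists_solvesFEM h0 ⟨hu.1, huk⟩ f
  refine ⟨uh, zh, hFEM, fun uh' zh' hFEM' => S.solvesFEM_unique h0 hFEM hFEM', ?_⟩
  have hM := happrox f u hu huk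
  have hU := StabFEM.seminormH_nonneg (k + 1) u
  set Y := h ^ k * StabFEM.seminormH Ω (k + 1) u with hYdef
  have hY : 0 ≤ Y := by positivity
  have hπ := hπV u (hle ⟨hu.1, huk⟩)
  have hi := hiV u ⟨hu.1, huk⟩
  have hgrad0 : 0 ≤ StabFEM.gradNorm Ω (u - πV u) := StabFEM.seminormH_nonneg _ _
  have hi' : ci * h ^ (k + 1) * StabFEM.seminormH Ω (k + 1) u = h * (ci * Y) := by
    rw [hYdef]
    ring
  rw [hi'] at hi
  have hi1 : ‖u - πV u‖ ≤ ci * (h * Y) := by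
    have := mul_nonneg hh0.le hgrad0
    linarith
  -- The gradient part of the interpolation estimate, divided by `h > 0`.
  have hi2 : StabFEM.gradNorm Ω (u - πV u) ≤ ci * Y :=
    le_of_mul_le_mul_left (by linarith [norm_nonneg (u - πV u)]) hh0
  have hd1 := S.gradNorm_discreteError_le hsasp hcΩ hci hcγ hcG hh0 hhD hY hgard hM hi1 hFEM
  have hmem : ∀ v ∈ Vh, v ∈ StabFEM.sobolev Ω 1 := fun v hv => (hVh hv).1
  have htri := StabFEM.seminormH_sub_le hΩ (sub_mem (hV hu.1) (hmem _ hπ))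
    (sub_mem (hmem _ hFEM.primal_mem) (hmem _ hπ))
  rw [sub_sub_sub_cancel_right] at htri
  calc StabFEM.gradNorm Ω (u - uh)
      ≤ StabFEM.gradNorm Ω (u - πV u) + StabFEM.gradNorm Ω (uh - πV u) := htri
    _ ≤ ci * Y + √(StabFEM.h1ConstSq cΩ ci ca cγ cG lam (Metric.diam (closure Ω))) * Y :=
        add_le_add hi2 hd1
    _ = _ := by
      rw [hYdef]
      ring
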